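/- Let $\ell$ be a prime number and let $d\ge 0$, $n\ge 0$ be integers. A family $\mathcal A$ of distinct subsets of $[n]=\{1,\dots,n\}$ is called a *$d$-defect $\ell$-oddtown* if every $A\in\mathcal A$ satisfies $|A|\not\equiv 0 \pmod \ell$ and, for every $A\in\mathcal A$, there are at most $d$ sets $B\in\mathcal A\setminus\{A\}$ with $|A\cap B|\not\equiv 0\pmod \ell$. **Theorem.** There is an absolute constant $C>0$ (independent of $\ell$, $d$, $n$ and $\mathcal A$) such that the following holds. Let $\ell$ be prime, let $\mathcal A$ be a $d$-defect $\ell$-oddtown in $[n]$, and suppose that $n\ge C\,d\log d$ (where $0\log 0:=0$) and, in the case $d=1$, that $n\ge 4$. Then $$|\mathcal A|\le (d+1)\Bigl(n-2\bigl(\lceil \log_2(d+2)\rceil-1\bigr)\Bigr).$$ -/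

import Mathlib

/-- A family `𝒜` of (distinct) subsets of an `n`-element universe is a `d`-defect `ℓ`-oddtown if
every member has size nonzero modulo `ℓ` and, for every member `A`, there are at most `d` members
`B ≠ A` such that `A ∩ B` has size nonzero modulo `ℓ`. -/
def IsDefectOddtown (d ℓ : ℕ) {n : ℕ} (𝒜 : Finset (Finset (Fin n))) : Prop :=
  ∀ A ∈ 𝒜, ¬ A.card ≡ 0 [MOD ℓ] ∧
    (𝒜.filter fun B => B ≠ A ∧ ¬ (A ∩ B).card ≡ 0 [MOD ℓ]).card ≤ d

/-!
Reduce the indicator vectors of the members of `𝒜` modulo `ℓ` and join two members when their dot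
product is nonzero. This gives a graph of maximum degree at most `d`; nonadjacent members are
orthogonal and no member is isotropic. Let `I` be a maximum independent set. Then
`|𝒜| ≤ (d + 1) |I|`, and `I` is linearly independent, so `|𝒜| ≤ (d + 1) n`. To save the
logarithmic term, consider the vertices `v ∈ I` having exactly `d` *private* neighbours, that is,
vertices whose only neighbour in `I` is `v`. By maximality of `I` the private neighbours of `v` form
a clique, so `v` and its neighbours are a clique of size `d + 1`, which is a whole component.

* Suppose the Gram matrix of one such component has rank one. Then its `d + 1` distinct vectors are
  multiples of one vector modulo a totally isotropic space `R` that is orthogonal to the whole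
  family. Since a space of dimension `s` contains at most `2 ^ s` vectors with 0/1 entries
  (`card_zero_one_vectors_le`), `d + 2 ≤ 2 ^ (dim R + 1)`. The space spanned by `I` and `R` lies in
  the orthogonal complement of `R`, so `|I| + 2 dim R ≤ n` (`card_add_two_mul_finrank_le`), and
  `|𝒜| ≤ (d + 1) |I|` gives the bound.
* Otherwise each of these components, `t` in number, contributes a second vector independent of all
  others, so `|I| + t ≤ n` (`card_add_card_le`). Counting the edges leaving `I`, as in Fajtlowicz's
  bound on the independence number, gives `2 |𝒜| ≤ (2 d + 1) |I| + t ≤ (2 d + 1) n`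
  (`two_mul_card_le`). This is below the required bound by a margin of order `n`, which absorbs the
  logarithmic term when `n ≥ 18 d log d`. For `d = 1` the margin is too small, but there
  `|𝒜| ≤ |I| + t ≤ n`, which is at most `2 (n - 2)` once `n ≥ 4`.
-/

open Finset Module

/-! ### Subspaces and 0/1 vectors -/

/-- A subspace of dimension `s` contains at most `2 ^ s` vectors with entries in `{0, 1}`: among the
coordinate functionals restricted to the subspace, a maximal independent set has at most `s`
members, and these coordinates determine every vector of the subspace. -/
theorem card_zero_one_vectors_le {F : Type*} [Field F] {n : ℕ} (W : Submodule F (Fin n → F))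
    (S : Finset (Fin n → F)) (hS : ∀ x ∈ S, ∀ i, x i = 0 ∨ x i = 1) (hW : ∀ x ∈ S, x ∈ W) :
    #S ≤ 2 ^ finrank F W := by
  classical
  let φ : Fin n → Dual F W := fun i => (LinearMap.proj i).comp W.subtype
  obtain ⟨κ, a, ha, hsp, hli⟩ := exists_linearIndependent' F φ
  have : Finite κ := Finite.of_injective a ha
  have := Fintype.ofFinite κ
  have hκ : Fintype.card κ ≤ finrank F W := by
    rw [← Subspace.dual_finrank_eq]
    exact hli.fintype_card_le_finrank
  have key : ∀ w : W, (∀ k, φ (a k) w = 0) → w = 0 := by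
    intro w hw
    have h1 : Submodule.span F (Set.range φ) ≤ LinearMap.ker (Dual.eval F W w) := by
      rw [← hsp, Submodule.span_le]
      rintro _ ⟨k, rfl⟩
      exact hw k
    ext i
    exact h1 (Submodule.subset_span ⟨i, rfl⟩)
  have hinj : Set.InjOn (fun (x : Fin n → F) (k : κ) => decide (x (a k) = 0)) (S : Set _) := by
    intro x hx y hy hxy
    have hx' := hS x hx
    have hy' := hS y hy
    have : (⟨x, hW x hx⟩ - ⟨y, hW y hy⟩ : W) = 0 := by
      apply key
      intro k
      have h2 := congrFun hxy k
      simp only [decide_eq_decide] at h2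
      change x (a k) - y (a k) = 0
      rcases hx' (a k) with h | h <;> rcases hy' (a k) with h' | h' <;> simp_all
    simpa [sub_eq_zero] using this
  calc #S ≤ #(univ : Finset (κ → Bool)) :=
        card_le_card_of_injOn _ (fun _ _ => mem_coe.2 (mem_univ _)) hinj
    _ = 2 ^ Fintype.card κ := by simp
    _ ≤ 2 ^ finrank F W := Nat.pow_le_pow_right (by norm_num) hκ

/-! ### Orthogonality for the dot product -/

section DotProduct

variable {F ι : Type*} [Field F] {n : ℕ}

/-- Pairwise orthogonal non-isotropic vectors span a nondegenerate subspace, so a totally isotropic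
subspace `R` orthogonal to all of them meets their span trivially; both lie in `Rᗮ`, which has
dimension `n - dim R`. -/
theorem card_add_two_mul_finrank_le (x : ι → Fin n → F) (I : Finset ι)
    (hx : ∀ i ∈ I, x i ⬝ᵥ x i ≠ 0) (hxx : ∀ i ∈ I, ∀ j ∈ I, i ≠ j → x i ⬝ᵥ x j = 0)
    (R : Submodule F (Fin n → F)) (hR : ∀ r ∈ R, ∀ s ∈ R, r ⬝ᵥ s = 0)
    (hxR : ∀ i ∈ I, ∀ r ∈ R, r ⬝ᵥ x i = 0) :
    #I + 2 * finrank F R ≤ n := by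
  classical
  let B : LinearMap.BilinForm F (Fin n → F) := Matrix.toBilin' 1
  have hB : ∀ u v, B u v = u ⬝ᵥ v := by
    intro u v
    simp [B, Matrix.toBilin'_apply']
  have hBn : B.Nondegenerate := LinearMap.BilinForm.nondegenerate_toBilin'_of_det_ne_zero' _ (by simp)
  have hcoef : ∀ c : I → F, ∀ j : I, (∑ i, c i • x i) ⬝ᵥ x j = c j * (x j ⬝ᵥ x j) := by
    intro c j
    rw [sum_dotProduct, Finset.sum_eq_single j]
    · simp
    · intro i _ hij
      rw [smul_dotProduct, hxx i i.2 j j.2 (fun hij' => hij (Subtype.ext hij')), smul_zero]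
    · simp
  have hli : LinearIndependent F (fun i : I => x i) := by
    rw [Fintype.linearIndependent_iff]
    intro c hc j
    have h := hcoef c j
    rw [hc, zero_dotProduct] at h
    exact (mul_eq_zero.1 h.symm).resolve_right (hx j j.2)
  set U := Submodule.span F (Set.range fun i : I => x i) with hU
  have hUcard : finrank F U = #I := by
    rw [hU, finrank_span_eq_card hli, Fintype.card_coe]
  have hdisj : U ⊓ R = ⊥ := by
    rw [eq_bot_iff]
    rintro y ⟨hyU, hyR⟩
    obtain ⟨c, rfl⟩ := (Submodule.mem_span_range_iff_exists_fun F).1 hyU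
    have hc : ∀ j, c j = 0 := by
      intro j
      have h := hcoef c j
      rw [hxR j j.2 _ hyR] at h
      exact (mul_eq_zero.1 h.symm).resolve_right (hx j j.2)
    simp [hc]
  have hle : U ⊔ R ≤ B.orthogonal R := by
    refine sup_le ?_ ?_
    · rw [hU, Submodule.span_le]
      rintro _ ⟨i, rfl⟩ r hr
      exact (hB _ _).trans (hxR i i.2 r hr)
    · intro s hs r hr
      exact (hB _ _).trans (hR r hr s hs)
  have h1 := Submodule.finrank_mono hle
  have h2 := Submodule.finrank_sup_add_finrank_inf_eq U R
  have h3 := LinearMap.BilinForm.finrank_add_finrank_orthogonal' (B := B) R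
  rw [hBn.ker_eq_bot, inf_bot_eq, finrank_bot] at h3
  rw [hdisj, finrank_bot] at h2
  simp only [finrank_fin_fun] at h3
  omega

/-- Pairwise orthogonal non-isotropic vectors `x i`, `i ∈ I`, stay independent when for each `i` in a
subset `T` a further vector `b i` is added, provided that the `b i` are orthogonal to the rest and
that a `2 × 2` Gram determinant witnesses that `x i` and `b i` are independent modulo the radical. -/
theorem card_add_card_le (x b e : ι → Fin n → F) (I T : Finset ι) (hTI : T ⊆ I)
    (hx : ∀ i ∈ I, x i ⬝ᵥ x i ≠ 0) (hxx : ∀ i ∈ I, ∀ j ∈ I, i ≠ j → x i ⬝ᵥ x j = 0)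
    (hbx : ∀ i ∈ T, ∀ j ∈ I, i ≠ j → b i ⬝ᵥ x j = 0)
    (hxe : ∀ i ∈ I, ∀ j ∈ T, i ≠ j → x i ⬝ᵥ e j = 0)
    (hbe : ∀ i ∈ T, ∀ j ∈ T, i ≠ j → b i ⬝ᵥ e j = 0)
    (hdet : ∀ i ∈ T, (x i ⬝ᵥ x i) * (b i ⬝ᵥ e i) ≠ (x i ⬝ᵥ e i) * (b i ⬝ᵥ x i)) :
    #I + #T ≤ n := by
  classical
  have hli : LinearIndependent F (Sum.elim (fun i : I => x i) (fun i : T => b i)) := by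
    rw [Fintype.linearIndependent_iff]
    intro c hc
    simp only [Fintype.sum_sum_type, Sum.elim_inl, Sum.elim_inr] at hc
    have hT : ∀ j : T, c (Sum.inl ⟨j, hTI j.2⟩) = 0 ∧ c (Sum.inr j) = 0 := by
      intro j
      have h : ∀ y : Fin n → F, (∀ i ∈ I, i ≠ j → x i ⬝ᵥ y = 0) →
          (∀ i ∈ T, i ≠ j → b i ⬝ᵥ y = 0) →
          c (Sum.inl ⟨j, hTI j.2⟩) * (x j ⬝ᵥ y) + c (Sum.inr j) * (b j ⬝ᵥ y) = 0 := by
        intro y h1 h2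
        have h3 := congrArg (· ⬝ᵥ y) hc
        simp only [add_dotProduct, sum_dotProduct, zero_dotProduct, smul_dotProduct,
          smul_eq_mul] at h3
        rw [Finset.sum_eq_single ⟨j, hTI j.2⟩, Finset.sum_eq_single j] at h3
        · exact h3
        · intro i _ hij
          rw [h2 i i.2 (fun hij' => hij (Subtype.ext hij')), mul_zero]
        · simp
        · intro i _ hij
          rw [h1 i i.2 (fun hij' => hij (Subtype.ext hij')), mul_zero]
        · simp
      have hj := hTI j.2
      have e1 := h (x j) (fun i hi hij => hxx i hi j hj hij) (fun i hi hij => hbx i hi j hj hij)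
      have e2 := h (e j) (fun i hi hij => hxe i hi j j.2 hij) (fun i hi hij => hbe i hi j j.2 hij)
      have hd := sub_ne_zero.2 (hdet j j.2)
      constructor
      · refine (mul_eq_zero.1 ?_).resolve_right hd
        linear_combination (b j ⬝ᵥ e j) * e1 - (b j ⬝ᵥ x j) * e2
      · refine (mul_eq_zero.1 ?_).resolve_right hd
        linear_combination (x j ⬝ᵥ x j) * e2 - (x j ⬝ᵥ e j) * e1
    rintro (j | j)
    · by_cases hj : (j : ι) ∈ T
      · exact (hT ⟨j, hj⟩).1
      · have h3 := congrArg (· ⬝ᵥ x j) hc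
        simp only [add_dotProduct, sum_dotProduct, zero_dotProduct, smul_dotProduct,
          smul_eq_mul] at h3
        rw [Finset.sum_eq_single j, Finset.sum_eq_zero, add_zero] at h3
        · exact (mul_eq_zero.1 h3).resolve_right (hx j j.2)
        · intro i _
          rw [(hT i).2, zero_mul]
        · intro i _ hij
          rw [hxx i i.2 j j.2 (fun hij' => hij (Subtype.ext hij')), mul_zero]
        · simp
    · exact (hT j).2
  simpa using hli.fintype_card_le_finrank

end DotProduct

/-! ### Private neighbours of a maximum independent set -/

section PrivateNeighbors

variable {ι : Type*} [Fintype ι] [DecidableEq ι] (G : SimpleGraph ι) [DecidableRel G.Adj]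

/-- The vertices whose only neighbour in `I` is `v`. For independent `I ∋ v` they lie outside `I`. -/
def privateNeighbors (I : Finset ι) (v : ι) : Finset ι :=
  univ.filter fun u => G.neighborFinset u ∩ I = {v}

variable {G} {I : Finset ι} {v : ι}

theorem mem_privateNeighbors {u : ι} :
    u ∈ privateNeighbors G I v ↔ ∀ w, (G.Adj u w ∧ w ∈ I) ↔ w = v := by
  simp [privateNeighbors, Finset.ext_iff]

theorem adj_of_mem_privateNeighbors {u : ι} (hu : u ∈ privateNeighbors G I v) : G.Adj v u :=
  ((mem_privateNeighbors.1 hu v).2 rfl).1.symm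

theorem privateNeighbors_subset : privateNeighbors G I v ⊆ G.neighborFinset v := fun u hu => by
  simpa using adj_of_mem_privateNeighbors hu

/-- Two nonadjacent private neighbours of `v` could replace `v` in the maximum independent set. -/
theorem adj_of_mem_privateNeighbors_of_ne (hI : G.IsMaximumIndepSet I) {u w : ι}
    (hu : u ∈ privateNeighbors G I v) (hw : w ∈ privateNeighbors G I v) (huw : u ≠ w) :
    G.Adj u w := by
  by_contra hadj
  have hu' := mem_privateNeighbors.1 hu
  have hw' := mem_privateNeighbors.1 hw
  have hind := hI.isIndepSet
  have hvI : v ∈ I := ((hu' v).2 rfl).2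
  have huI : u ∉ I := fun h => hind hvI h (adj_of_mem_privateNeighbors hu).ne
    (adj_of_mem_privateNeighbors hu)
  have hwI : w ∉ I := fun h => hind hvI h (adj_of_mem_privateNeighbors hw).ne
    (adj_of_mem_privateNeighbors hw)
  have hnew : G.IsIndepSet (insert u (insert w (I.erase v)) : Finset ι) := by
    rw [SimpleGraph.isIndepSet_iff]
    intro a ha c hc hac h
    simp only [coe_insert, Set.mem_insert_iff, mem_coe, mem_erase] at ha hc
    have k1 : ∀ z ∈ I, z ≠ v → ¬ G.Adj u z := fun z hz hzv hz' => hzv ((hu' z).1 ⟨hz', hz⟩)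
    have k2 : ∀ z ∈ I, z ≠ v → ¬ G.Adj w z := fun z hz hzv hz' => hzv ((hw' z).1 ⟨hz', hz⟩)
    rcases ha with rfl | rfl | ⟨ha, ha'⟩ <;> rcases hc with rfl | rfl | ⟨hc, hc'⟩
    · exact hac rfl
    · exact hadj h
    · exact k1 c hc' hc h
    · exact hadj h.symm
    · exact hac rfl
    · exact k2 c hc' hc h
    · exact k1 a ha' ha h.symm
    · exact k2 a ha' ha h.symm
    · exact hind ha' hc' hac h
  have := hI.maximum _ hnew
  rw [card_insert_of_notMem, card_insert_of_notMem, card_erase_of_mem hvI] at this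
  · have := card_pos.2 ⟨v, hvI⟩
    omega
  · simp [hwI]
  · simp [huI, huw]

theorem exists_adj_of_notMem (hI : G.IsMaximumIndepSet I) {u : ι} (hu : u ∉ I) :
    ∃ w ∈ I, G.Adj u w := by
  by_contra! h
  have hnew : G.IsIndepSet (insert u I : Finset ι) := by
    rw [SimpleGraph.isIndepSet_iff]
    intro a ha c hc hac hadj
    simp only [coe_insert, Set.mem_insert_iff, mem_coe] at ha hc
    rcases ha with rfl | ha <;> rcases hc with rfl | hc
    · exact hac rfl
    · exact h c hc hadj
    · exact h a ha hadj.symm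
    · exact hI.isIndepSet ha hc hac hadj
  have := hI.maximum _ hnew
  rw [card_insert_of_notMem hu] at this
  omega

/-- Double counting of the edges between `I` and its complement. -/
theorem sum_card_neighborFinset_inter_le {d : ℕ} (hd : ∀ v, #(G.neighborFinset v) ≤ d) :
    ∑ u ∈ Iᶜ, #(G.neighborFinset u ∩ I) ≤ d * #I := by
  calc ∑ u ∈ Iᶜ, #(G.neighborFinset u ∩ I)
      = ∑ u ∈ Iᶜ, #(I.bipartiteAbove G.Adj u) := by
        refine sum_congr rfl fun u _ => congrArg card ?_
        ext w
        simp [bipartiteAbove, and_comm]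
    _ = ∑ v ∈ I, #(Iᶜ.bipartiteBelow G.Adj v) :=
        sum_card_bipartiteAbove_eq_sum_card_bipartiteBelow _
    _ ≤ ∑ _v ∈ I, d := by
        refine sum_le_sum fun v _ => (card_le_card ?_).trans (hd v)
        intro u hu
        simp only [bipartiteBelow, mem_filter] at hu
        simpa using hu.2.symm
    _ = d * #I := by rw [sum_const, smul_eq_mul, mul_comm]

theorem card_neighborFinset_inter_pos (hI : G.IsMaximumIndepSet I) {u : ι} (hu : u ∈ Iᶜ) :
    1 ≤ #(G.neighborFinset u ∩ I) := by
  obtain ⟨w, hw, huw⟩ := exists_adj_of_notMem hI (mem_compl.1 hu)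
  exact card_pos.2 ⟨w, by simp [hw, huw]⟩

theorem card_le_succ_mul_card {d : ℕ} (hd : ∀ v, #(G.neighborFinset v) ≤ d)
    (hI : G.IsMaximumIndepSet I) : Fintype.card ι ≤ (d + 1) * #I := by
  have h1 : #Iᶜ ≤ ∑ u ∈ Iᶜ, #(G.neighborFinset u ∩ I) := by
    rw [card_eq_sum_ones]
    exact sum_le_sum fun u hu => card_neighborFinset_inter_pos hI hu
  have h2 := sum_card_neighborFinset_inter_le (I := I) hd
  have h3 := card_add_card_compl I
  linarith

/-- The vertices of `I` whose private neighbours use up the whole degree bound `d`. -/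
def saturatedVertices (G : SimpleGraph ι) [DecidableRel G.Adj] (I : Finset ι) (d : ℕ) : Finset ι :=
  I.filter fun v => #(privateNeighbors G I v) = d

theorem sum_card_privateNeighbors (hI : G.IsMaximumIndepSet I) :
    ∑ v ∈ I, #(privateNeighbors G I v) = #(Iᶜ.filter fun u => #(G.neighborFinset u ∩ I) = 1) := by
  rw [← card_biUnion]
  · congr 1
    ext u
    simp only [mem_biUnion, mem_filter, mem_compl, card_eq_one]
    constructor
    · rintro ⟨v, hv, hu⟩
      have hvu := adj_of_mem_privateNeighbors hu
      exact ⟨fun h => hI.isIndepSet hv h hvu.ne hvu, v, (mem_filter.1 hu).2⟩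
    · rintro ⟨_, v, hv⟩
      have hv' : v ∈ G.neighborFinset u ∩ I := by rw [hv]; exact mem_singleton_self v
      exact ⟨v, (mem_inter.1 hv').2, mem_filter.2 ⟨mem_univ _, hv⟩⟩
  · intro v _ w _ hvw
    refine disjoint_left.2 fun u hu hu' => hvw ?_
    exact singleton_injective ((mem_filter.1 hu).2.symm.trans (mem_filter.1 hu').2)

theorem sum_card_privateNeighbors_le {d : ℕ} (hd : ∀ v, #(G.neighborFinset v) ≤ d + 1) :
    ∑ v ∈ I, #(privateNeighbors G I v) ≤ d * #I + #(saturatedVertices G I (d + 1)) := by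
  calc ∑ v ∈ I, #(privateNeighbors G I v)
      ≤ ∑ v ∈ I, (d + if #(privateNeighbors G I v) = d + 1 then 1 else 0) := by
        refine sum_le_sum fun v _ => ?_
        have := (card_le_card (privateNeighbors_subset (G := G) (I := I) (v := v))).trans (hd v)
        split_ifs <;> omega
    _ = d * #I + #(saturatedVertices G I (d + 1)) := by
        rw [sum_add_distrib, sum_const, smul_eq_mul, mul_comm, saturatedVertices, card_filter]

/-- Fajtlowicz's count: a vertex outside `I` that is not a private neighbour sends at least two edges
to `I`, and the private neighbours number at most `d - 1` per vertex of `I`, up to the saturated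
vertices. -/
theorem two_mul_card_le {d : ℕ} (hd : ∀ v, #(G.neighborFinset v) ≤ d)
    (hI : G.IsMaximumIndepSet I) :
    2 * Fintype.card ι ≤ (2 * d + 1) * #I + #(saturatedVertices G I d) := by
  have h2 := sum_card_neighborFinset_inter_le (I := I) hd
  have h3 := card_add_card_compl I
  have h1 : 2 * #Iᶜ ≤ ∑ u ∈ Iᶜ, #(G.neighborFinset u ∩ I) +
      #(Iᶜ.filter fun u => #(G.neighborFinset u ∩ I) = 1) := by
    rw [card_filter, ← sum_add_distrib, mul_comm, ← smul_eq_mul, ← sum_const]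
    refine sum_le_sum fun u hu => ?_
    have := card_neighborFinset_inter_pos hI hu
    split_ifs <;> omega
  rw [← sum_card_privateNeighbors hI] at h1
  rcases d with _ | d
  · have h4 : ∀ v, #(privateNeighbors G I v) = 0 := fun v =>
      Nat.le_zero.1 ((card_le_card privateNeighbors_subset).trans (hd v))
    have h5 : saturatedVertices G I 0 = I := filter_true_of_mem fun v _ => h4 v
    rw [sum_eq_zero fun v _ => h4 v] at h1
    rw [h5]
    linarith
  · have h4 := sum_card_privateNeighbors_le (I := I) hd
    linarith

theorem card_le_card_add_card_saturatedVertices (hd : ∀ v, #(G.neighborFinset v) ≤ 1)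
    (hI : G.IsMaximumIndepSet I) :
    Fintype.card ι ≤ #I + #(saturatedVertices G I 1) := by
  have h1 : (Iᶜ.filter fun u => #(G.neighborFinset u ∩ I) = 1) = Iᶜ := by
    refine filter_true_of_mem fun u hu => le_antisymm ?_ (card_neighborFinset_inter_pos hI hu)
    exact (card_le_card inter_subset_left).trans (hd u)
  have h2 := sum_card_privateNeighbors_le (I := I) hd
  rw [sum_card_privateNeighbors hI, h1, zero_mul, zero_add, zero_add] at h2
  have h3 := card_add_card_compl I
  omega

theorem neighborFinset_eq_privateNeighbors {d : ℕ} (hd : ∀ v, #(G.neighborFinset v) ≤ d)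
    (hv : v ∈ saturatedVertices G I d) : G.neighborFinset v = privateNeighbors G I v :=
  (eq_of_subset_of_card_le privateNeighbors_subset
    ((hd v).trans (mem_filter.1 hv).2.ge)).symm

/-- The closed neighbourhood of a saturated vertex is a clique on `d + 1` vertices, hence a connected
component. -/
theorem mem_of_adj_of_mem_saturatedVertices {d : ℕ} (hd : ∀ v, #(G.neighborFinset v) ≤ d)
    (hI : G.IsMaximumIndepSet I) (hv : v ∈ saturatedVertices G I d) {u w : ι}
    (hu : u ∈ insert v (G.neighborFinset v)) (huw : G.Adj u w) :
    w ∈ insert v (G.neighborFinset v) := by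
  have hP := neighborFinset_eq_privateNeighbors hd hv
  have hcard : #(insert v (G.neighborFinset v)) = d + 1 := by
    rw [card_insert_of_notMem (by simp), hP, (mem_filter.1 hv).2]
  have hsub : (insert v (G.neighborFinset v)).erase u ⊆ G.neighborFinset u := by
    intro z hz
    obtain ⟨hzu, hz⟩ := mem_erase.1 hz
    rw [SimpleGraph.mem_neighborFinset]
    rcases mem_insert.1 hu with rfl | hu <;> rcases mem_insert.1 hz with rfl | hz
    · exact absurd rfl hzu
    · simpa using hz
    · exact ((G.mem_neighborFinset _ _).1 hu).symm
    · rw [hP] at hu hz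
      exact adj_of_mem_privateNeighbors_of_ne hI hu hz hzu.symm
  have heq := eq_of_subset_of_card_le hsub (by
    rw [card_erase_of_mem hu, hcard]
    exact hd u)
  have : w ∈ G.neighborFinset u := by simpa using huw
  rw [← heq] at this
  exact (mem_erase.1 this).2

end PrivateNeighbors

/-! ### The dichotomy for saturated vertices -/

section Dichotomy

variable {F ι : Type*} [Field F] [Fintype ι] [DecidableEq ι] {n d : ℕ}
  {G : SimpleGraph ι} [DecidableRel G.Adj] {I : Finset ι}

/-- If the Gram matrix of the `d + 1` distinct 0/1 vectors in the closed neighbourhood of a saturated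
vertex `v` has rank one, then, up to multiples of `x v`, they lie in a totally isotropic subspace
orthogonal to everything. It has dimension `r` with `d + 2 ≤ 2 ^ (r + 1)`, since the zero vector may
be counted along with them. -/
theorem exists_card_add_two_mul_le (x : ι → Fin n → F) (hinj : Function.Injective x)
    (h01 : ∀ a i, x a i = 0 ∨ x a i = 1) (hself : ∀ a, x a ⬝ᵥ x a ≠ 0)
    (hG : ∀ a b, G.Adj a b ↔ a ≠ b ∧ x a ⬝ᵥ x b ≠ 0)
    (hd : ∀ v, #(G.neighborFinset v) ≤ d) (hI : G.IsMaximumIndepSet I) {v : ι}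
    (hv : v ∈ saturatedVertices G I d)
    (hrank : ∀ b ∈ insert v (G.neighborFinset v), ∀ e ∈ insert v (G.neighborFinset v),
      (x v ⬝ᵥ x v) * (x b ⬝ᵥ x e) = (x v ⬝ᵥ x e) * (x b ⬝ᵥ x v)) :
    ∃ r : ℕ, #I + 2 * r ≤ n ∧ d + 2 ≤ 2 ^ (r + 1) := by
  classical
  set K := insert v (G.neighborFinset v) with hK
  have hcard : #K = d + 1 := by
    rw [hK, card_insert_of_notMem (by simp), neighborFinset_eq_privateNeighbors hd hv,
      (mem_filter.1 hv).2]
  have horth : ∀ a c, a ≠ c → ¬ G.Adj a c → x a ⬝ᵥ x c = 0 := by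
    intro a c hac h
    by_contra h0
    exact h ((hG a c).2 ⟨hac, h0⟩)
  let ρ : ι → Fin n → F := fun b => x b - ((x b ⬝ᵥ x v) / (x v ⬝ᵥ x v)) • x v
  have hρ : ∀ b ∈ K, ∀ e, ρ b ⬝ᵥ x e = 0 := by
    intro b hb e
    have hval : ρ b ⬝ᵥ x e = x b ⬝ᵥ x e - (x b ⬝ᵥ x v) / (x v ⬝ᵥ x v) * (x v ⬝ᵥ x e) := by
      simp only [ρ, sub_dotProduct, smul_dotProduct, smul_eq_mul]
    have hs := hself v
    rw [hval]
    by_cases he : e ∈ K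
    · have := hrank b hb e he
      field_simp
      linear_combination this
    · have h1 : ∀ a ∈ K, x a ⬝ᵥ x e = 0 := fun a ha =>
        horth a e (by rintro rfl; exact he ha)
          fun h => he (mem_of_adj_of_mem_saturatedVertices hd hI hv ha h)
      rw [h1 b hb, h1 v (mem_insert_self _ _)]
      simp
  set R := Submodule.span F (ρ '' (K : Set ι)) with hR
  have hRx : ∀ e, ∀ r ∈ R, r ⬝ᵥ x e = 0 := by
    intro e r hr
    induction hr using Submodule.span_induction with
    | mem r hr =>
      obtain ⟨b, hb, rfl⟩ := hr
      exact hρ b hb e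
    | zero => simp
    | add a c _ _ ha hc => rw [add_dotProduct, ha, hc, add_zero]
    | smul t a _ ha => rw [smul_dotProduct, ha, smul_zero]
  have hRR : ∀ r ∈ R, ∀ s ∈ R, r ⬝ᵥ s = 0 := by
    intro r hr s hs
    induction hs using Submodule.span_induction with
    | mem s hs =>
      obtain ⟨b, _, rfl⟩ := hs
      simp only [ρ, dotProduct_sub, dotProduct_smul, hRx _ r hr, smul_zero, sub_zero]
    | zero => simp
    | add a c _ _ ha hc => rw [dotProduct_add, ha, hc, add_zero]
    | smul t a _ ha => rw [dotProduct_smul, ha, smul_zero]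
  refine ⟨finrank F R, card_add_two_mul_finrank_le x I (fun i _ => hself i)
    (fun i hi j hj hij => horth i j hij (hI.isIndepSet hi hj hij)) R hRR fun i _ => hRx i, ?_⟩
  let W := Submodule.span F {x v} ⊔ R
  have hxW : ∀ b ∈ K, x b ∈ W := by
    intro b hb
    have : x b = ((x b ⬝ᵥ x v) / (x v ⬝ᵥ x v)) • x v + ρ b := by simp [ρ]
    rw [this]
    exact Submodule.add_mem_sup (Submodule.smul_mem _ _ (Submodule.mem_span_singleton_self _))
      (Submodule.subset_span ⟨b, hb, rfl⟩)
  have h0 : (0 : Fin n → F) ∉ K.image x := by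
    intro h
    obtain ⟨b, _, hb⟩ := mem_image.1 h
    exact hself b (by rw [hb, zero_dotProduct])
  have h1 := card_zero_one_vectors_le W (insert 0 (K.image x))
    (by
      intro y hy i
      rcases mem_insert.1 hy with rfl | hy
      · exact Or.inl rfl
      · obtain ⟨b, _, rfl⟩ := mem_image.1 hy
        exact h01 b i)
    (by
      intro y hy
      rcases mem_insert.1 hy with rfl | hy
      · exact zero_mem _
      · obtain ⟨b, hb, rfl⟩ := mem_image.1 hy
        exact hxW b hb)
  rw [card_insert_of_notMem h0, card_image_of_injective _ hinj, hcard] at h1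
  have h2 : finrank F W ≤ finrank F R + 1 := by
    have h3 := Submodule.finrank_add_le_finrank_add_finrank (Submodule.span F {x v}) R
    have h4 := finrank_span_le_card (R := F) ({x v} : Set (Fin n → F))
    simp only [Set.toFinset_singleton, card_singleton] at h4
    change finrank F W ≤ _ at h3
    omega
  exact h1.trans (Nat.pow_le_pow_right (by norm_num) h2)

/-- If no saturated vertex has a closed neighbourhood whose Gram matrix has rank one, then each of
them contributes a second independent vector. -/
theorem card_add_card_saturatedVertices_le (x : ι → Fin n → F) (hself : ∀ a, x a ⬝ᵥ x a ≠ 0)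
    (hG : ∀ a b, G.Adj a b ↔ a ≠ b ∧ x a ⬝ᵥ x b ≠ 0)
    (hd : ∀ v, #(G.neighborFinset v) ≤ d) (hI : G.IsMaximumIndepSet I)
    (hrank : ∀ v ∈ saturatedVertices G I d,
      ∃ b ∈ insert v (G.neighborFinset v), ∃ e ∈ insert v (G.neighborFinset v),
      (x v ⬝ᵥ x v) * (x b ⬝ᵥ x e) ≠ (x v ⬝ᵥ x e) * (x b ⬝ᵥ x v)) :
    #I + #(saturatedVertices G I d) ≤ n := by
  classical
  have hrank' : ∀ v, ∃ b e, v ∈ saturatedVertices G I d →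
      b ∈ insert v (G.neighborFinset v) ∧ e ∈ insert v (G.neighborFinset v) ∧
      (x v ⬝ᵥ x v) * (x b ⬝ᵥ x e) ≠ (x v ⬝ᵥ x e) * (x b ⬝ᵥ x v) := by
    intro v
    by_cases hv : v ∈ saturatedVertices G I d
    · obtain ⟨b, hb, e, he, h⟩ := hrank v hv
      exact ⟨b, e, fun _ => ⟨hb, he, h⟩⟩
    · exact ⟨v, v, fun h => absurd h hv⟩
  choose b e hbe using hrank'
  have hT : saturatedVertices G I d ⊆ I := filter_subset _ _
  have hind := hI.isIndepSet
  have horth : ∀ v ∈ saturatedVertices G I d, ∀ a ∈ insert v (G.neighborFinset v),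
      ∀ c ∉ insert v (G.neighborFinset v), x a ⬝ᵥ x c = 0 := by
    intro v hv a ha c hc
    by_contra h0
    refine hc (mem_of_adj_of_mem_saturatedVertices hd hI hv ha ((hG a c).2 ⟨?_, h0⟩))
    rintro rfl
    exact hc ha
  have hout : ∀ i ∈ I, ∀ j ∈ I, i ≠ j → j ∉ insert i (G.neighborFinset i) := by
    intro i hi j hj hij h
    rcases mem_insert.1 h with h | h
    · exact hij h.symm
    · exact hind hi hj hij (by simpa using h)
  -- Distinct closed neighbourhoods are disjoint because each of them is a whole component.
  have hout' : ∀ i ∈ saturatedVertices G I d, ∀ j ∈ saturatedVertices G I d, i ≠ j →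
      ∀ c ∈ insert j (G.neighborFinset j), c ∉ insert i (G.neighborFinset i) := by
    intro i hi j hj hij c hc hc'
    refine hout i (hT hi) j (hT hj) hij ?_
    rcases mem_insert.1 hc with rfl | hc
    · exact hc'
    · exact mem_of_adj_of_mem_saturatedVertices hd hI hi hc' (by simpa using (show G.Adj j c by
        simpa using hc).symm)
  refine card_add_card_le x (fun v => x (b v)) (fun v => x (e v)) I _ hT (fun i _ => hself i)
    ?_ ?_ ?_ ?_ fun v hv => (hbe v hv).2.2
  · intro i hi j hj hij
    by_contra h0
    exact hind hi hj hij ((hG i j).2 ⟨hij, h0⟩)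
  · intro i hi j hj hij
    exact horth i hi _ (hbe i hi).1 j (hout i (hT hi) j hj hij)
  · intro i hi j hj hij
    rw [dotProduct_comm]
    exact horth j hj _ (hbe j hj).2.1 i (hout j (hT hj) i hi hij.symm)
  · intro i hi j hj hij
    exact horth i hi _ (hbe i hi).1 _ (hout' i hi j hj hij _ (hbe j hj).2.1)

/-- Either some totally isotropic subspace of dimension `r ≥ log₂ (d + 2) - 1` costs `2 r` dimensions,
or the family has at most `(d + 1 / 2) n` members, and at most `n` if `d = 1`. -/
theorem card_dichotomy (G : SimpleGraph ι) [DecidableRel G.Adj] (x : ι → Fin n → F)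
    (hinj : Function.Injective x)
    (h01 : ∀ a i, x a i = 0 ∨ x a i = 1) (hself : ∀ a, x a ⬝ᵥ x a ≠ 0)
    (hG : ∀ a b, G.Adj a b ↔ a ≠ b ∧ x a ⬝ᵥ x b ≠ 0)
    (hd : ∀ v, #(G.neighborFinset v) ≤ d) :
    (∃ m r : ℕ, Fintype.card ι ≤ (d + 1) * m ∧ m + 2 * r ≤ n ∧ d + 2 ≤ 2 ^ (r + 1)) ∨
    (2 * Fintype.card ι ≤ (2 * d + 1) * n ∧ (d = 1 → Fintype.card ι ≤ n)) := by
  obtain ⟨I, hI⟩ := G.maximumIndepSet_exists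
  by_cases hrank : ∃ v ∈ saturatedVertices G I d,
      ∀ b ∈ insert v (G.neighborFinset v), ∀ e ∈ insert v (G.neighborFinset v),
      (x v ⬝ᵥ x v) * (x b ⬝ᵥ x e) = (x v ⬝ᵥ x e) * (x b ⬝ᵥ x v)
  · obtain ⟨v, hv, h⟩ := hrank
    obtain ⟨r, h1, h2⟩ := exists_card_add_two_mul_le x hinj h01 hself hG hd hI hv h
    exact Or.inl ⟨#I, r, card_le_succ_mul_card hd hI, h1, h2⟩
  · push Not at hrank
    have h1 := card_add_card_saturatedVertices_le x hself hG hd hI hrank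
    refine Or.inr ⟨?_, ?_⟩
    · have h2 := two_mul_card_le hd hI
      nlinarith [Nat.zero_le (d * #(saturatedVertices G I d)), Nat.mul_le_mul_left d h1]
    · rintro rfl
      exact (card_le_card_add_card_saturatedVertices hd hI).trans h1

end Dichotomy

/-! ### Defect oddtowns -/

theorem indicator_dotProduct_indicator {F : Type*} [Field F] {n : ℕ} (A B : Finset (Fin n)) :
    (fun i => if i ∈ A then (1 : F) else 0) ⬝ᵥ (fun i => if i ∈ B then (1 : F) else 0) =
      (#(A ∩ B) : F) := by
  simp [dotProduct, ← ite_and, ← mem_inter, inter_comm]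

theorem IsDefectOddtown.card_dichotomy {ℓ d n : ℕ} {𝒜 : Finset (Finset (Fin n))} (hℓ : ℓ.Prime)
    (h : IsDefectOddtown d ℓ 𝒜) :
    (∃ m r : ℕ, #𝒜 ≤ (d + 1) * m ∧ m + 2 * r ≤ n ∧ d + 2 ≤ 2 ^ (r + 1)) ∨
    (2 * #𝒜 ≤ (2 * d + 1) * n ∧ (d = 1 → #𝒜 ≤ n)) := by
  classical
  have := Fact.mk hℓ
  let x : 𝒜 → Fin n → ZMod ℓ := fun A i => if i ∈ (A : Finset (Fin n)) then 1 else 0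
  have hdot : ∀ A B : 𝒜, x A ⬝ᵥ x B ≠ 0 ↔ ¬ #((A : Finset (Fin n)) ∩ B) ≡ 0 [MOD ℓ] := by
    intro A B
    rw [← ZMod.natCast_eq_natCast_iff, Nat.cast_zero, ← indicator_dotProduct_indicator]
  let G : SimpleGraph 𝒜 :=
    { Adj := fun A B => A ≠ B ∧ x A ⬝ᵥ x B ≠ 0
      symm := ⟨fun A B hAB => ⟨hAB.1.symm, by rw [dotProduct_comm]; exact hAB.2⟩⟩
      loopless := ⟨fun A hA => hA.1 rfl⟩ }
  have key := _root_.card_dichotomy (d := d) G x ?_ ?_ ?_ (fun _ _ => Iff.rfl) ?_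
  · simpa only [Fintype.card_coe] using key
  · intro A B hAB
    ext i
    have := congrFun hAB i
    by_cases h1 : i ∈ (A : Finset (Fin n)) <;> by_cases h2 : i ∈ (B : Finset (Fin n)) <;>
      simp_all [x]
  · intro A i
    by_cases h1 : i ∈ (A : Finset (Fin n)) <;> simp [x, h1]
  · intro A
    rw [hdot, inter_self]
    exact (h A A.2).1
  · intro A
    refine le_trans ?_ (h A A.2).2
    rw [← card_map (Function.Embedding.subtype _)]
    refine card_le_card fun B hB => ?_
    obtain ⟨B, hB, rfl⟩ := mem_map.1 hB
    have hAB : G.Adj A B := by simpa using hB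
    exact mem_filter.2 ⟨B.2, fun h => hAB.1 (Subtype.ext h.symm), (hdot A B).1 hAB.2⟩

/-! ### Numerical estimates -/

theorem ceil_logb_le_of_le_two_pow {d r : ℕ} (h : d + 2 ≤ 2 ^ (r + 1)) :
    ⌈Real.logb 2 ((d : ℝ) + 2)⌉ - 1 ≤ (r : ℤ) := by
  have h1 : ((d : ℝ) + 2) ≤ 2 ^ (r + 1) := by exact_mod_cast h
  have h2 : Real.logb 2 ((d : ℝ) + 2) ≤ ((r + 1 : ℤ) : ℝ) := by
    rw [Real.logb_le_iff_le_rpow (by norm_num) (by positivity)]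
    refine h1.trans_eq ?_
    rw [← Real.rpow_natCast]
    push_cast
    rfl
  have := Int.ceil_le.2 h2
  omega

/-- The constant `18` works because `⌈log₂ (d + 2)⌉ - 1 < 2 log₂ d`, `d + 1 ≤ 3 d / 2` and
`log 2 > 2 / 3`. -/
theorem four_mul_succ_mul_ceil_logb_le {d n : ℕ} (hd : 2 ≤ d)
    (h : 18 * (d : ℝ) * Real.log (d : ℝ) ≤ (n : ℝ)) :
    4 * ((d : ℤ) + 1) * (⌈Real.logb 2 ((d : ℝ) + 2)⌉ - 1) ≤ n := by
  have hd' : (2 : ℝ) ≤ d := by exact_mod_cast hd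
  have hlog2 : (2 : ℝ) / 3 < Real.log 2 := lt_trans (by norm_num) Real.log_two_gt_d9
  have hlogd : 0 ≤ Real.log d := Real.log_nonneg (by linarith)
  have h1 : Real.log ((d : ℝ) + 2) ≤ 2 * Real.log d := by
    rw [← Real.log_rpow (by linarith)]
    refine Real.log_le_log (by linarith) ?_
    rw [Real.rpow_two]
    nlinarith
  have h2 : Real.logb 2 ((d : ℝ) + 2) ≤ 3 * Real.log d := by
    rw [Real.logb, div_le_iff₀ (by linarith)]
    nlinarith
  have h3 : (⌈Real.logb 2 ((d : ℝ) + 2)⌉ : ℝ) - 1 ≤ 3 * Real.log d := by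
    linarith [Int.ceil_lt_add_one (Real.logb 2 ((d : ℝ) + 2))]
  have h4 : 4 * ((d : ℝ) + 1) * ((⌈Real.logb 2 ((d : ℝ) + 2)⌉ : ℝ) - 1) ≤ n := by
    refine le_trans (mul_le_mul_of_nonneg_left h3 (by linarith)) (le_trans ?_ h)
    nlinarith
  exact_mod_cast h4

theorem theorem1p5 :
    ∃ C : ℝ, 0 < C ∧
      ∀ (ℓ d n : ℕ) (𝒜 : Finset (Finset (Fin n))),
        ℓ.Prime →
        IsDefectOddtown d ℓ 𝒜 →
        C * (d : ℝ) * Real.log (d : ℝ) ≤ (n : ℝ) →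
        (d = 1 → 4 ≤ n) →
        (𝒜.card : ℤ) ≤
          ((d : ℤ) + 1) * ((n : ℤ) - 2 * (⌈Real.logb 2 ((d : ℝ) + 2)⌉ - 1)) := by
  refine ⟨18, by norm_num, fun ℓ d n 𝒜 hℓ h hn hn1 => ?_⟩
  rcases h.card_dichotomy hℓ with ⟨m, r, h1, h2, h3⟩ | ⟨h1, h2⟩
  · have h4 := ceil_logb_le_of_le_two_pow h3
    have h1' : (#𝒜 : ℤ) ≤ ((d : ℤ) + 1) * m := by exact_mod_cast h1
    refine h1'.trans (mul_le_mul_of_nonneg_left ?_ (by positivity))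
    omega
  · have h1' : 2 * (#𝒜 : ℤ) ≤ (2 * (d : ℤ) + 1) * n := by exact_mod_cast h1
    obtain rfl | rfl | hd : d = 0 ∨ d = 1 ∨ 2 ≤ d := by omega
    · have h4 := ceil_logb_le_of_le_two_pow (d := 0) (r := 0) (by norm_num)
      push_cast at h1' h4 ⊢
      linarith
    · have h4 := ceil_logb_le_of_le_two_pow (d := 1) (r := 1) (by norm_num)
      have h5 := h2 rfl
      have h6 := hn1 rfl
      push_cast at h4 ⊢
      omega
    · have h4 := four_mul_succ_mul_ceil_logb_le hd hn
      linarith
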